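/- For positive integers $s_1\ge 2$, $s_2,\dots,s_d\ge 1$ let $\zeta(s_1,\dots,s_d)=\sum_{k_1>\dots>k_d>0} k_1^{-s_1}\cdots k_d^{-s_d}$ be the multiple zeta value. Write $\bigoplus_{\mathcal S(a,b,c)} f(a,b,c)$ for the sum of $f$ over all six permutations of its arguments $(a,b,c)$, and $\bigoplus_{\mathcal C(b,c)} f(b,c)=f(b,c)+f(c,b)$ (with $a$ held fixed). Let $a,b,c$ be real numbers and let $n\ge 4$ be an integer. Then $$\begin{aligned} &\bigoplus_{\mathcal S(a,b,c)}\bigg\{\sum_{\substack{j\ge 2,\;k,l\ge 1\\ j+k+l=n}}\Big(ac(a+b+c)^{j-1}(a+b)^{k-1}b^l-ac(a+b)^{j+k-2}b^l-ac(b+c)^{j-1}b^{k+l-1}\\ &\qquad\qquad +ac\,b^{j+k+l-2}-a^jb^kc^l\Big)\zeta(j,k,l)\\ &\qquad +\sum_{\substack{j\ge 2,\;k\ge 1\\ j+k=n}}\Big(ca^jb^{k-1}+ca^kb^{j-1}-\frac{b(a^jc^k+a^kc^j)}{c-b}\Big)\zeta(j,k)\bigg\}\\ &-\bigoplus_{\mathcal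 C(b,c)}\bigg\{\frac{1}{c-b}\Big(\frac{abc^n-bca^n}{c-a}+acb^{n-1}\Big)-\frac{ac(b^{n-1}-a^{n-1})}{b-a}+ca^{n-1}\bigg\}\zeta(n)\\ =&\bigoplus_{\mathcal S(a,b,c)}\bigg\{\sum_{\substack{j\ge 2,\;k\ge 1\\ j+k=n-1}}\Big(a^kbc\big[(a+c)^{j-1}-a^{j-1}-c^{j-1}\big]\zeta(j,k,1)-a^jbc^k\,\zeta(j,1,k)\Big)\\ &\qquad +\Big(a^{n-1}c+a^{n-2}bc-\frac{abc^{n-1}}{c-b}\Big)\zeta(n-1,1)\\ &\qquad +\tfrac12a^{n-2}bc\big(\zeta(n-2,2)+\zeta(2,n-2)\big)+\tfrac12a^{n-2}bc\,\zeta(n)\bigg\}. \end{aligned}$$ Here $0^0=1$. The identity holds literally when $a,b,c$ are pairwise distinct. When some of $a,b,c$ coincide it is understood by continuity: at every point $(a,b,c)\in\mathbb R^3$ each of the two sides, as a function on the set of pairwise distinct triples, has a finite limit, and the two limits are equal. -/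

import Mathlib

open Filter Topology

noncomputable section

/-- The multiple zeta value
`ζ(s₁, …, s_d) = ∑_{k₁ > ⋯ > k_d > 0} 1 / (k₁ ^ s₁ ⋯ k_d ^ s_d)` of depth `d`
(an absolutely convergent series whenever `s₁ ≥ 2` and all `sᵢ ≥ 1`). -/
def mzv {d : ℕ} (s : Fin d → ℕ) : ℝ :=
  ∑' k : {k : Fin d → ℕ // StrictAnti k ∧ ∀ i, 0 < k i}, ∏ i, 1 / ((k.1 i : ℝ) ^ s i)

/-- The pairs `(j, k)` with `j ≥ 2`, `k ≥ 1` and `j + k = n`. -/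
def pairsOfWeight (n : ℕ) : Finset (ℕ × ℕ) :=
  (Finset.HasAntidiagonal.antidiagonal n).filter fun p => 2 ≤ p.1 ∧ 1 ≤ p.2

/-- The triples `(j, k, l)` with `j ≥ 2`, `k, l ≥ 1` and `j + k + l = n`. -/
def triplesOfWeight (n : ℕ) : Finset (Fin 3 → ℕ) :=
  (Finset.Nat.antidiagonalTuple 3 n).filter fun p => 2 ≤ p 0 ∧ 1 ≤ p 1 ∧ 1 ≤ p 2

/-- `⨁_{𝒮(x₁, x₂, x₃)} f(x₁, x₂, x₃)`: the sum of `f(x_{σ(1)}, x_{σ(2)}, x_{σ(3)})` over all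
permutations `σ`. -/
def symSum (x₁ x₂ x₃ : ℝ) (f : ℝ → ℝ → ℝ → ℝ) : ℝ :=
  ∑ σ : Equiv.Perm (Fin 3),
    f (![x₁, x₂, x₃] (σ 0)) (![x₁, x₂, x₃] (σ 1)) (![x₁, x₂, x₃] (σ 2))

/-- `⨁_{𝒞(x₁, x₂)} f(x₁, x₂)`: the sum of `f` over the cyclic shifts of `(x₁, x₂)`. -/
def cycSum (x₁ x₂ : ℝ) (f : ℝ → ℝ → ℝ) : ℝ :=
  ∑ i : Fin 2, f (![x₁, x₂] i) (![x₁, x₂] (i + 1))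

/-- The left-hand side of the identity. -/
def identityLHS (n : ℕ) (a₀ b₀ c₀ : ℝ) : ℝ :=
  symSum a₀ b₀ c₀ (fun a b c =>
    (∑ p ∈ triplesOfWeight n,
      let j := p 0
      let k := p 1
      let l := p 2
      (a * c * (a + b + c) ^ (j - 1) * (a + b) ^ (k - 1) * b ^ l
        - a * c * (a + b) ^ (j + k - 2) * b ^ l
        - a * c * (b + c) ^ (j - 1) * b ^ (k + l - 1)
        + a * c * b ^ (j + k + l - 2)
        - a ^ j * b ^ k * c ^ l) * mzv ![j, k, l])
    + ∑ p ∈ pairsOfWeight n,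
      let j := p.1
      let k := p.2
      (c * a ^ j * b ^ (k - 1) + c * a ^ k * b ^ (j - 1)
        - b * (a ^ j * c ^ k + a ^ k * c ^ j) / (c - b)) * mzv ![j, k])
  - cycSum b₀ c₀ (fun b c =>
      let a := a₀
      1 / (c - b) * ((a * b * c ^ n - b * c * a ^ n) / (c - a) + a * c * b ^ (n - 1))
        - a * c * (b ^ (n - 1) - a ^ (n - 1)) / (b - a) + c * a ^ (n - 1)) * mzv ![n]

/-- The right-hand side of the identity. -/
def identityRHS (n : ℕ) (a₀ b₀ c₀ : ℝ) : ℝ :=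
  symSum a₀ b₀ c₀ (fun a b c =>
    (∑ p ∈ pairsOfWeight (n - 1),
      let j := p.1
      let k := p.2
      (a ^ k * b * c * ((a + c) ^ (j - 1) - a ^ (j - 1) - c ^ (j - 1)) * mzv ![j, k, 1]
        - a ^ j * b * c ^ k * mzv ![j, 1, k]))
    + (a ^ (n - 1) * c + a ^ (n - 2) * b * c - a * b * c ^ (n - 1) / (c - b)) * mzv ![n - 1, 1]
    + 1 / 2 * a ^ (n - 2) * b * c * (mzv ![n - 2, 2] + mzv ![2, n - 2])
    + 1 / 2 * a ^ (n - 2) * b * c * mzv ![n])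

/-- The triples of pairwise distinct real numbers: the set where no denominator of the identity
vanishes. -/
def distinctTriples : Set (ℝ × ℝ × ℝ) :=
  {p | p.1 ≠ p.2.1 ∧ p.1 ≠ p.2.2 ∧ p.2.1 ≠ p.2.2}

end

noncomputable section

/-! Expand the sum over positive integers `x, y, z` of `(1/(x-aX) - 1/x)(1/(y-bX) - 1/y)(1/(z-cX) -
1/z)` in powers of `X`. The coefficient of `X^m` is an absolutely convergent series, the generating
polynomial of the products `ζ(i)ζ(j)ζ(k)` with `i, j, k ≥ 2` and `i+j+k = m+3`. It is evaluated
twice.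

Sorting `(x, y, z)` by size, ties included, gives the stuffle expansion
`hasSum_stuffleTerm_stuffle`. Iterating `1/(uv) = (1/(u+v))(1/u + 1/v)` produces the denominators
`x+y+z > x+y > x` and gives the shuffle expansion `hasSum_stuffleTerm_shuffle`. Uniqueness of sums
equates the two.

The identity is this equality at weight `n = m+3`, multiplied by `abc` and sorted by depth:
`depth_three`, `depth_two` and `depth_one_coeff` identify the pieces. The special values such as
`ζ(j,k,1)` and `ζ(n-1,1)` arise because the subtracted terms `1/x, 1/y, 1/z` contribute powers
`0^i`, nonzero only at `i = 0`.

For coinciding arguments, the poles of the right side are removable, and the left side inherits the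
limit because the two sides agree on distinct triples. -/

open Finset in
theorem symSum_eq (a b c : ℝ) (f : ℝ → ℝ → ℝ → ℝ) :
    symSum a b c f = f a b c + f a c b + f b a c + f b c a + f c a b + f c b a := by
  have h : (univ : Finset (Equiv.Perm (Fin 3))) =
      {1, Equiv.swap 1 2, Equiv.swap 0 1, Equiv.swap 0 1 * Equiv.swap 1 2,
        Equiv.swap 0 2 * Equiv.swap 1 2, Equiv.swap 0 2} := by decide
  have e : ∀ σ : Equiv.Perm (Fin 3), ∀ i j, σ i = j → ![a, b, c] (σ i) = ![a, b, c] j := by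
    intro σ i j h; rw [h]
  rw [symSum, h, sum_insert (by decide), sum_insert (by decide), sum_insert (by decide),
    sum_insert (by decide), sum_insert (by decide), sum_singleton]
  rw [e 1 0 0 (by decide), e 1 1 1 (by decide), e 1 2 2 (by decide),
    e (Equiv.swap 1 2) 0 0 (by decide), e (Equiv.swap 1 2) 1 2 (by decide),
    e (Equiv.swap 1 2) 2 1 (by decide),
    e (Equiv.swap 0 1) 0 1 (by decide), e (Equiv.swap 0 1) 1 0 (by decide),
    e (Equiv.swap 0 1) 2 2 (by decide),
    e (Equiv.swap 0 1 * Equiv.swap 1 2) 0 1 (by decide),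
    e (Equiv.swap 0 1 * Equiv.swap 1 2) 1 2 (by decide),
    e (Equiv.swap 0 1 * Equiv.swap 1 2) 2 0 (by decide),
    e (Equiv.swap 0 2 * Equiv.swap 1 2) 0 2 (by decide),
    e (Equiv.swap 0 2 * Equiv.swap 1 2) 1 0 (by decide),
    e (Equiv.swap 0 2 * Equiv.swap 1 2) 2 1 (by decide),
    e (Equiv.swap 0 2) 0 2 (by decide), e (Equiv.swap 0 2) 1 1 (by decide),
    e (Equiv.swap 0 2) 2 0 (by decide)]
  simp
  ring

theorem cycSum_eq (b c : ℝ) (f : ℝ → ℝ → ℝ) : cycSum b c f = f b c + f c b := by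
  simp [cycSum, Fin.sum_univ_two]

/-! ### Absolute convergence of multiple zeta values -/

/-- The summand of the multiple zeta value, extended by zero to all tuples of positive integers. -/
def mzvTerm {d : ℕ} (s : Fin d → ℕ) (v : Fin d → ℕ+) : ℝ :=
  if StrictAnti v then ∏ i, (((v i : ℕ) : ℝ) ^ s i)⁻¹ else 0

theorem mzv_eq_tsum {d : ℕ} (s : Fin d → ℕ) : mzv s = ∑' v, mzvTerm s v := by
  let e : {v : Fin d → ℕ+ // StrictAnti v} ≃
      {k : Fin d → ℕ // StrictAnti k ∧ ∀ i, 0 < k i} :=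
    { toFun := fun v => ⟨fun i => v.1 i, fun _ _ h => v.2 h, fun i => (v.1 i).2⟩
      invFun := fun k => ⟨fun i => ⟨k.1 i, k.2.2 i⟩, fun _ _ h => k.2.1 h⟩
      left_inv := fun v => rfl
      right_inv := fun k => rfl }
  rw [mzv, ← e.tsum_eq]
  have h := tsum_subtype {v : Fin d → ℕ+ | StrictAnti v}
    (fun v => ∏ i, (((v i : ℕ) : ℝ) ^ s i)⁻¹)
  have h2 : ({v : Fin d → ℕ+ | StrictAnti v}.indicator
      (fun v => ∏ i, (((v i : ℕ) : ℝ) ^ s i)⁻¹)) = mzvTerm s := by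
    ext v; by_cases hv : StrictAnti v <;> simp [mzvTerm, Set.indicator, hv]
  rw [h2] at h
  rw [← h]
  exact tsum_congr fun v => Finset.prod_congr rfl fun i _ => one_div _

theorem summable_fin_prod {α : Type*} {f : α → ℝ} (hf : Summable f) (h0 : ∀ x, 0 ≤ f x) (d : ℕ) :
    Summable fun v : Fin d → α => ∏ i, f (v i) := by
  induction d with
  | zero => exact Summable.of_finite
  | succ d ih =>
    rw [← (Fin.consEquiv fun _ : Fin (d + 1) => α).summable_iff]
    have := hf.mul_of_nonneg ih h0 (fun v => Finset.prod_nonneg fun i _ => h0 _)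
    refine this.congr fun p => ?_
    simp [Fin.prod_univ_succ, Fin.consEquiv]

theorem summable_mzvTerm {d : ℕ} (s : Fin (d + 1) → ℕ) (h0 : 2 ≤ s 0) (h1 : ∀ i, 1 ≤ s i) :
    Summable (mzvTerm s) := by
  -- With this `e`, the bound `v i ≤ v 0` gives `∏ (v i)^e ≤ v 0`. So the one spare power of `v 0`
  -- from `2 ≤ s 0` pays for raising every exponent from `1` to `1 + e`, and a product of convergent
  -- series dominates.
  set e : ℝ := 1 / (d + 1 : ℝ) with he
  have hd : (0 : ℝ) < d + 1 := by positivity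
  have hepos : 0 < e := by positivity
  have hs : Summable fun k : ℕ+ => (((k : ℕ) : ℝ) ^ (1 + e))⁻¹ :=
    ((Real.summable_nat_rpow_inv).2 (by linarith)).comp_injective PNat.coe_injective
  refine Summable.of_nonneg_of_le (fun v => ?_) (fun v => ?_)
    (summable_fin_prod hs (fun _ => by positivity) (d + 1))
  · unfold mzvTerm; split_ifs <;> positivity
  · unfold mzvTerm
    split_ifs with hv
    · rw [Finset.prod_inv_distrib, Finset.prod_inv_distrib]
      have hx : ∀ i, (1 : ℝ) ≤ ((v i : ℕ) : ℝ) := fun i => by exact_mod_cast (v i).2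
      refine inv_anti₀ (Finset.prod_pos fun i _ => Real.rpow_pos_of_pos (by linarith [hx i]) _) ?_
      have h2 : ∏ i, ((v i : ℕ) : ℝ) ^ e ≤ ((v 0 : ℕ) : ℝ) := by
        calc ∏ i, ((v i : ℕ) : ℝ) ^ e ≤ ∏ _i : Fin (d + 1), ((v 0 : ℕ) : ℝ) ^ e := by
              refine Finset.prod_le_prod (fun i _ => by positivity) fun i _ => ?_
              refine Real.rpow_le_rpow (by positivity) ?_ hepos.le
              exact_mod_cast hv.antitone (Fin.zero_le i)
          _ = ((v 0 : ℕ) : ℝ) := by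
              rw [Finset.prod_const, Finset.card_univ, Fintype.card_fin, ← Real.rpow_natCast,
                ← Real.rpow_mul (by positivity), he]
              push_cast
              rw [one_div_mul_cancel hd.ne', Real.rpow_one]
      calc ∏ i, ((v i : ℕ) : ℝ) ^ (1 + e)
          = (∏ i, ((v i : ℕ) : ℝ)) * ∏ i, ((v i : ℕ) : ℝ) ^ e := by
            rw [← Finset.prod_mul_distrib]
            refine Finset.prod_congr rfl fun i _ => ?_
            rw [Real.rpow_add (by linarith [hx i]), Real.rpow_one]
        _ ≤ (∏ i, ((v i : ℕ) : ℝ)) * ((v 0 : ℕ) : ℝ) := by gcongr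
        _ ≤ ∏ i, ((v i : ℕ) : ℝ) ^ s i := by
            rw [Fin.prod_univ_succ, Fin.prod_univ_succ, mul_right_comm, ← sq]
            gcongr with i
            · exact hx 0
            · calc ((v i.succ : ℕ) : ℝ) = ((v i.succ : ℕ) : ℝ) ^ 1 := (pow_one _).symm
                _ ≤ _ := pow_le_pow_right₀ (hx _) (h1 _)
    · positivity

/-! ### Index sets of fixed weight and products of geometric series -/

section

open Finset

/-- A Cauchy product yields all exponents `≥ 1`, while convergence requires a leading exponent `≥
2`; `hf` discards the difference. -/
theorem sum_triplesOfWeight (m : ℕ) (f : ℕ → ℕ → ℕ → ℝ) (hf : ∀ k l, f 1 k l = 0) :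
    ∑ p ∈ triplesOfWeight (m + 3), f (p 0) (p 1) (p 2) =
      ∑ p ∈ antidiagonal m, ∑ q ∈ antidiagonal p.1, f (q.1 + 1) (q.2 + 1) (p.2 + 1) := by
  rw [sum_sigma' (antidiagonal m) (fun p => antidiagonal p.1)
    (fun p q => f (q.1 + 1) (q.2 + 1) (p.2 + 1))]
  rw [← sum_filter_of_ne (p := fun s : (_ : ℕ × ℕ) × ℕ × ℕ => s.2.1 ≠ 0)]
  · refine sum_nbij' (fun p => ⟨(p 0 + p 1 - 2, p 2 - 1), (p 0 - 1, p 1 - 1)⟩)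
      (fun s => ![s.2.1 + 1, s.2.2 + 1, s.1.2 + 1]) ?_ ?_ ?_ ?_ ?_
    · intro p hp
      simp only [triplesOfWeight, mem_filter, Finset.Nat.mem_antidiagonalTuple,
        Fin.sum_univ_three] at hp
      simp only [mem_filter, mem_sigma, HasAntidiagonal.mem_antidiagonal]
      omega
    · rintro ⟨⟨i, l⟩, j, k⟩ h
      simp only [mem_filter, mem_sigma, HasAntidiagonal.mem_antidiagonal] at h
      simp [triplesOfWeight, Finset.Nat.mem_antidiagonalTuple, Fin.sum_univ_three]
      omega
    · intro p hp
      simp only [triplesOfWeight, mem_filter, Finset.Nat.mem_antidiagonalTuple,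
        Fin.sum_univ_three] at hp
      ext i
      fin_cases i <;> simp <;> omega
    · rintro ⟨⟨i, l⟩, j, k⟩ h
      simp only [mem_filter, mem_sigma, HasAntidiagonal.mem_antidiagonal] at h
      obtain ⟨⟨-, rfl⟩, -⟩ := h
      simp
      omega
    · intro p hp
      simp only [triplesOfWeight, mem_filter, Finset.Nat.mem_antidiagonalTuple,
        Fin.sum_univ_three] at hp
      obtain ⟨h, h0, h1, h2⟩ := hp
      dsimp only
      rw [Nat.sub_add_cancel (by omega), Nat.sub_add_cancel h1, Nat.sub_add_cancel h2]
  · rintro ⟨⟨i, l⟩, j, k⟩ - h rfl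
    exact h (hf _ _)

theorem sum_pairsOfWeight (m : ℕ) (f : ℕ → ℕ → ℝ) :
    ∑ p ∈ pairsOfWeight (m + 3), f p.1 p.2 = ∑ q ∈ antidiagonal m, f (q.1 + 2) (q.2 + 1) := by
  refine sum_nbij' (fun p => (p.1 - 2, p.2 - 1)) (fun q => (q.1 + 2, q.2 + 1)) ?_ ?_ ?_ ?_ ?_
  · rintro ⟨j, k⟩ h
    simp [pairsOfWeight] at h ⊢
    omega
  · rintro ⟨j, k⟩ h
    simp [pairsOfWeight] at h ⊢
    omega
  · rintro ⟨j, k⟩ h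
    simp [pairsOfWeight] at h ⊢
    omega
  · rintro ⟨j, k⟩ h
    simp
  · rintro ⟨j, k⟩ h
    simp only [pairsOfWeight, mem_filter] at h
    dsimp only
    rw [Nat.sub_add_cancel h.2.1, Nat.sub_add_cancel h.2.2]

/-- Both ends of the antidiagonal of `m + 1` vanish, so either may be dropped. This form serves ties
among the two smaller variables, where the second exponent starts at `2`. -/
theorem sum_pairsOfWeight' (m : ℕ) (f : ℕ → ℕ → ℝ) (h1 : ∀ k, f 1 k = 0) (h2 : ∀ j, f j 1 = 0) :
    ∑ p ∈ pairsOfWeight (m + 3), f p.1 p.2 = ∑ q ∈ antidiagonal m, f (q.1 + 1) (q.2 + 2) := by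
  have e1 := Finset.Nat.sum_antidiagonal_succ (n := m) (f := fun q : ℕ × ℕ => f (q.1 + 1) (q.2 + 1))
  have e2 := Finset.Nat.sum_antidiagonal_succ' (n := m) (f := fun q : ℕ × ℕ => f (q.1 + 1) (q.2 + 1))
  simp only [zero_add, h1, h2] at e1 e2
  rw [sum_pairsOfWeight, ← e1, e2]

open PowerSeries

/-- The geometric series `1 / (x - α X) = ∑ αⁱ x⁻ⁱ⁻¹ Xⁱ`. -/
def geomSeries (α x : ℝ) : ℝ⟦X⟧ := PowerSeries.mk fun i => α ^ i * x⁻¹ ^ (i + 1)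

theorem geomSeries_mul (α : ℝ) {x : ℝ} (hx : x ≠ 0) :
    geomSeries α x * (C x - C α * X) = 1 := by
  ext i
  rw [mul_sub, map_sub, mul_comm _ (C x), ← mul_assoc, mul_comm _ (C α), coeff_C_mul]
  cases i with
  | zero => simp [geomSeries, hx]
  | succ i =>
    rw [coeff_succ_mul_X, coeff_C_mul]
    simp [geomSeries, coeff_one]
    field_simp
    ring

/-- This is `1/(uv) = (1/(u+v))(1/u + 1/v)` for `u = x - αX` and `v = y - βX`. -/
theorem geomSeries_mul_geomSeries (α β : ℝ) {x y : ℝ} (hx : 0 < x) (hy : 0 < y) :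
    geomSeries α x * geomSeries β y =
      geomSeries (α + β) (x + y) * (geomSeries α x + geomSeries β y) := by
  have h1 := geomSeries_mul α hx.ne'
  have h2 := geomSeries_mul β hy.ne'
  have h3 := geomSeries_mul (α + β) (add_pos hx hy).ne'
  rw [map_add, map_add] at h3
  linear_combination (-geomSeries α x * geomSeries β y) * h3 +
    geomSeries (α + β) (x + y) * geomSeries β y * h1 +
    geomSeries (α + β) (x + y) * geomSeries α x * h2

/-- The shuffle product of three geometric series. -/
theorem geomSeries_shuffle (α β γ : ℝ) {x y z : ℝ} (hx : 0 < x) (hy : 0 < y) (hz : 0 < z) :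
    geomSeries α x * geomSeries β y * geomSeries γ z =
      geomSeries (α + β + γ) (x + y + z) *
        (geomSeries (α + β) (x + y) * (geomSeries α x + geomSeries β y) +
         geomSeries (α + γ) (x + z) * (geomSeries α x + geomSeries γ z) +
         geomSeries (β + γ) (y + z) * (geomSeries β y + geomSeries γ z)) := by
  rw [← geomSeries_mul_geomSeries α β hx hy, ← geomSeries_mul_geomSeries α γ hx hz,
    ← geomSeries_mul_geomSeries β γ hy hz]
  have h1 := geomSeries_mul α hx.ne'
  have h2 := geomSeries_mul β hy.ne'
  have h3 := geomSeries_mul γ hz.ne'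
  have h4 := geomSeries_mul (α + β + γ) (add_pos (add_pos hx hy) hz).ne'
  rw [map_add, map_add, map_add, map_add] at h4
  linear_combination (-geomSeries α x * geomSeries β y * geomSeries γ z) * h4 +
    geomSeries (α + β + γ) (x + y + z) * geomSeries β y * geomSeries γ z * h1 +
    geomSeries (α + β + γ) (x + y + z) * geomSeries α x * geomSeries γ z * h2 +
    geomSeries (α + β + γ) (x + y + z) * geomSeries α x * geomSeries β y * h3

/-- The mixed third difference `∑ ± f` over the points obtained by replacing some of the arguments
by `0`. -/
def mixedDiff (f : ℝ → ℝ → ℝ → ℝ) (a b c : ℝ) : ℝ :=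
  f a b c - f a b 0 - f a 0 c - f 0 b c + f a 0 0 + f 0 b 0 + f 0 0 c - f 0 0 0

/-- The coefficient of `Xᵐ` in a product of three geometric series. -/
def coeffThree (m : ℕ) (α β γ x y z : ℝ) : ℝ :=
  coeff m (geomSeries α x * geomSeries β y * geomSeries γ z)

theorem coeffThree_eq_sum (m : ℕ) (α β γ x y z : ℝ) :
    coeffThree m α β γ x y z = ∑ p ∈ antidiagonal m, ∑ q ∈ antidiagonal p.1,
      α ^ q.1 * β ^ q.2 * γ ^ p.2 * (x⁻¹ ^ (q.1 + 1) * y⁻¹ ^ (q.2 + 1) * z⁻¹ ^ (p.2 + 1)) := by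
  rw [coeffThree, coeff_mul]
  refine sum_congr rfl fun p _ => ?_
  rw [coeff_mul, sum_mul]
  refine sum_congr rfl fun q _ => ?_
  simp only [geomSeries, coeff_mk]
  ring

/-- The homogeneous part of degree `m` of the stuffle side summand. -/
def stuffleTerm (m : ℕ) (a b c x y z : ℝ) : ℝ :=
  mixedDiff (fun a b c => coeffThree m a b c x y z) a b c

theorem stuffleTerm_eq_coeff (m : ℕ) (a b c x y z : ℝ) :
    stuffleTerm m a b c x y z = coeff m ((geomSeries a x - geomSeries 0 x) *
      (geomSeries b y - geomSeries 0 y) * (geomSeries c z - geomSeries 0 z)) := by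
  simp only [stuffleTerm, mixedDiff, coeffThree, ← map_sub, ← map_add]
  congr 1
  ring

/-- The homogeneous part of degree `m` of the shuffle side summand. -/
def shuffleTerm (m : ℕ) (a b c x y z : ℝ) : ℝ :=
  mixedDiff (fun a b c => coeffThree m (a + b + c) (a + b) a x y z) a b c

theorem coeffThree_shuffle (m : ℕ) (a b c : ℝ) {x y z : ℝ} (hx : 0 < x) (hy : 0 < y)
    (hz : 0 < z) :
    coeffThree m a b c x y z =
      coeffThree m (a + b + c) (a + b) a (x + y + z) (x + y) x +
      coeffThree m (a + c + b) (a + c) a (x + z + y) (x + z) x +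
      coeffThree m (b + a + c) (b + a) b (y + x + z) (y + x) y +
      coeffThree m (b + c + a) (b + c) b (y + z + x) (y + z) y +
      coeffThree m (c + a + b) (c + a) c (z + x + y) (z + x) z +
      coeffThree m (c + b + a) (c + b) c (z + y + x) (z + y) z := by
  rw [show a + c + b = a + b + c by ring, show b + a + c = a + b + c by ring,
    show b + c + a = a + b + c by ring, show c + a + b = a + b + c by ring,
    show c + b + a = a + b + c by ring, show x + z + y = x + y + z by ring,
    show y + x + z = x + y + z by ring, show y + z + x = x + y + z by ring,
    show z + x + y = x + y + z by ring, show z + y + x = x + y + z by ring,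
    add_comm b a, add_comm y x, add_comm c a, add_comm z x, add_comm c b, add_comm z y]
  simp only [coeffThree, ← map_add]
  rw [geomSeries_shuffle a b c hx hy hz]
  congr 1
  ring

/-- The partial fraction identity holds at each of the eight parameter triples of the mixed
difference. Each parameter stays attached to its variable, so the differences regroup by
permutation. -/
theorem stuffleTerm_eq_shuffleTerm (m : ℕ) (a b c : ℝ) {x y z : ℝ} (hx : 0 < x) (hy : 0 < y)
    (hz : 0 < z) :
    stuffleTerm m a b c x y z =
      shuffleTerm m a b c (x + y + z) (x + y) x + shuffleTerm m a c b (x + z + y) (x + z) x +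
      shuffleTerm m b a c (y + x + z) (y + x) y + shuffleTerm m b c a (y + z + x) (y + z) y +
      shuffleTerm m c a b (z + x + y) (z + x) z + shuffleTerm m c b a (z + y + x) (z + y) z := by
  unfold stuffleTerm shuffleTerm mixedDiff
  simp only [coeffThree_shuffle m _ _ _ hx hy hz]
  ring

/-- The coefficients of the shuffle side. -/
def shuffleCoeff (j k l : ℕ) (a b c : ℝ) : ℝ :=
  mixedDiff (fun a b c => (a + b + c) ^ (j - 1) * (a + b) ^ (k - 1) * a ^ (l - 1)) a b c

theorem shuffleTerm_eq_sum (m : ℕ) (a b c x y z : ℝ) :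
    shuffleTerm m a b c x y z = ∑ p ∈ triplesOfWeight (m + 3),
      shuffleCoeff (p 0) (p 1) (p 2) a b c * (x⁻¹ ^ p 0 * y⁻¹ ^ p 1 * z⁻¹ ^ p 2) := by
  rw [sum_triplesOfWeight m
    (fun j k l => shuffleCoeff j k l a b c * (x⁻¹ ^ j * y⁻¹ ^ k * z⁻¹ ^ l))]
  · simp only [shuffleTerm, mixedDiff, coeffThree_eq_sum, ← sum_sub_distrib, ← sum_add_distrib]
    refine sum_congr rfl fun p _ => sum_congr rfl fun q _ => ?_
    simp only [shuffleCoeff, mixedDiff, Nat.add_sub_cancel]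
    ring
  -- At `j = 1` the monomial `(a+b)^(k-1) a^(l-1)` does not involve `c`, so its mixed difference is
  -- zero: the divergent values never occur.
  · intro k l
    simp only [shuffleCoeff, mixedDiff]
    ring

/-- The coefficients of the strict part of the stuffle side. -/
def stuffleCoeff (j k l : ℕ) (a b c : ℝ) : ℝ :=
  (a ^ (j - 1) - 0 ^ (j - 1)) * (b ^ (k - 1) - 0 ^ (k - 1)) * (c ^ (l - 1) - 0 ^ (l - 1))

theorem stuffleTerm_eq_sum (m : ℕ) (a b c x y z : ℝ) :
    stuffleTerm m a b c x y z = ∑ p ∈ triplesOfWeight (m + 3),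
      stuffleCoeff (p 0) (p 1) (p 2) a b c * (x⁻¹ ^ p 0 * y⁻¹ ^ p 1 * z⁻¹ ^ p 2) := by
  rw [sum_triplesOfWeight m
    (fun j k l => stuffleCoeff j k l a b c * (x⁻¹ ^ j * y⁻¹ ^ k * z⁻¹ ^ l))]
  · simp only [stuffleTerm, mixedDiff, coeffThree_eq_sum, ← sum_sub_distrib, ← sum_add_distrib]
    refine sum_congr rfl fun p _ => sum_congr rfl fun q _ => ?_
    simp only [stuffleCoeff, Nat.add_sub_cancel]
    ring
  · intro k l
    simp [stuffleCoeff]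

/-- The sum of the monomials `a ^ (i - 1) * b ^ (j - 1)` with `i, j ≥ 2` and `i + j = k`. -/
def innerCoeff (k : ℕ) (a b : ℝ) : ℝ :=
  match k with
  | 0 => 0
  | 1 => 0
  | k + 2 => ∑ p ∈ antidiagonal k, (a ^ p.1 - 0 ^ p.1) * (b ^ p.2 - 0 ^ p.2)

theorem geomSeries_sub_mul (a b x : ℝ) :
    (geomSeries a x - geomSeries 0 x) * (geomSeries b x - geomSeries 0 x) =
      PowerSeries.mk fun i => innerCoeff (i + 2) a b * x⁻¹ ^ (i + 2) := by
  ext i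
  rw [coeff_mul, coeff_mk, innerCoeff, sum_mul]
  refine sum_congr rfl fun p hp => ?_
  rw [← HasAntidiagonal.mem_antidiagonal.1 hp]
  simp only [map_sub, geomSeries, coeff_mk]
  ring

theorem stuffleTerm_diag_left (m : ℕ) (a b c x z : ℝ) :
    stuffleTerm m a b c x x z = ∑ p ∈ pairsOfWeight (m + 3),
      innerCoeff p.1 a b * (c ^ (p.2 - 1) - 0 ^ (p.2 - 1)) * (x⁻¹ ^ p.1 * z⁻¹ ^ p.2) := by
  rw [sum_pairsOfWeight m (fun j k =>
    innerCoeff j a b * (c ^ (k - 1) - 0 ^ (k - 1)) * (x⁻¹ ^ j * z⁻¹ ^ k)),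
    stuffleTerm_eq_coeff, geomSeries_sub_mul, coeff_mul]
  refine sum_congr rfl fun p _ => ?_
  simp only [map_sub, geomSeries, coeff_mk, Nat.add_sub_cancel]
  ring

theorem stuffleTerm_diag_right (m : ℕ) (a b c x z : ℝ) :
    stuffleTerm m a b c x z z = ∑ p ∈ pairsOfWeight (m + 3),
      (a ^ (p.1 - 1) - 0 ^ (p.1 - 1)) * innerCoeff p.2 b c * (x⁻¹ ^ p.1 * z⁻¹ ^ p.2) := by
  rw [sum_pairsOfWeight' m (fun j k =>
    (a ^ (j - 1) - 0 ^ (j - 1)) * innerCoeff k b c * (x⁻¹ ^ j * z⁻¹ ^ k)),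
    stuffleTerm_eq_coeff, mul_assoc, geomSeries_sub_mul, coeff_mul]
  · refine sum_congr rfl fun p _ => ?_
    simp only [map_sub, geomSeries, coeff_mk, Nat.add_sub_cancel]
    ring
  · simp
  · simp [innerCoeff]

/-- The sum of the monomials `a ^ (i - 1) * b ^ (j - 1) * c ^ (k - 1)` with `i, j, k ≥ 2` and
`i + j + k = m + 3`. -/
def diagCoeff (m : ℕ) (a b c : ℝ) : ℝ :=
  ∑ p ∈ antidiagonal m, innerCoeff (p.1 + 2) a b * (c ^ p.2 - 0 ^ p.2)

theorem stuffleTerm_diag (m : ℕ) (a b c x : ℝ) :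
    stuffleTerm m a b c x x x = diagCoeff m a b c * x⁻¹ ^ (m + 3) := by
  rw [stuffleTerm_eq_coeff, geomSeries_sub_mul, coeff_mul, diagCoeff, sum_mul]
  refine sum_congr rfl fun p hp => ?_
  rw [← HasAntidiagonal.mem_antidiagonal.1 hp]
  simp only [map_sub, geomSeries, coeff_mk]
  ring

theorem stuffleTerm_perm (m : ℕ) (a b c x y z : ℝ) :
    stuffleTerm m a c b x z y = stuffleTerm m a b c x y z ∧
    stuffleTerm m b a c y x z = stuffleTerm m a b c x y z ∧
    stuffleTerm m b c a y z x = stuffleTerm m a b c x y z ∧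
    stuffleTerm m c a b z x y = stuffleTerm m a b c x y z ∧
    stuffleTerm m c b a z y x = stuffleTerm m a b c x y z := by
  simp only [stuffleTerm_eq_coeff]
  refine ⟨?_, ?_, ?_, ?_, ?_⟩ <;> · congr 1; ring

end

/-! ### Summation over triples: the shuffle and stuffle expansions -/

theorem strictAnti_fin_three (v : Fin 3 → ℕ+) : StrictAnti v ↔ v 2 < v 1 ∧ v 1 < v 0 := by
  rw [Fin.strictAnti_iff_succ_lt]
  simp [Fin.forall_fin_two, and_comm]

theorem strictAnti_fin_two (v : Fin 2 → ℕ+) : StrictAnti v ↔ v 1 < v 0 := by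
  rw [Fin.strictAnti_iff_succ_lt]
  simp

theorem hasSum_mzvTerm {d : ℕ} (s : Fin (d + 1) → ℕ) (h0 : 2 ≤ s 0) (h1 : ∀ i, 1 ≤ s i) :
    HasSum (mzvTerm s) (mzv s) := by
  rw [mzv_eq_tsum]
  exact (summable_mzvTerm s h0 h1).hasSum

theorem hasSum_triple (n : ℕ) (c : (Fin 3 → ℕ) → ℝ) :
    HasSum (fun v : Fin 3 → ℕ+ => if v 2 < v 1 ∧ v 1 < v 0 then
      ∑ p ∈ triplesOfWeight n, c p * (((v 0 : ℕ) : ℝ)⁻¹ ^ p 0 * ((v 1 : ℕ) : ℝ)⁻¹ ^ p 1 *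
        ((v 2 : ℕ) : ℝ)⁻¹ ^ p 2) else 0)
      (∑ p ∈ triplesOfWeight n, c p * mzv ![p 0, p 1, p 2]) := by
  have h : ∀ p ∈ triplesOfWeight n, HasSum (fun v => c p * mzvTerm ![p 0, p 1, p 2] v)
      (c p * mzv ![p 0, p 1, p 2]) := by
    intro p hp
    simp only [triplesOfWeight, Finset.mem_filter] at hp
    refine (hasSum_mzvTerm _ hp.2.1 ?_).mul_left _
    intro i
    fin_cases i <;> simp <;> omega
  refine (hasSum_sum h).congr_fun ?_
  intro v
  simp only [mzvTerm, strictAnti_fin_three]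
  split_ifs
  · simp [Fin.prod_univ_three, mul_comm]
  · simp

theorem hasSum_pair (n : ℕ) (c : ℕ × ℕ → ℝ) :
    HasSum (fun v : Fin 2 → ℕ+ => if v 1 < v 0 then
      ∑ p ∈ pairsOfWeight n, c p * (((v 0 : ℕ) : ℝ)⁻¹ ^ p.1 * ((v 1 : ℕ) : ℝ)⁻¹ ^ p.2) else 0)
      (∑ p ∈ pairsOfWeight n, c p * mzv ![p.1, p.2]) := by
  have h : ∀ p ∈ pairsOfWeight n, HasSum (fun v => c p * mzvTerm ![p.1, p.2] v)
      (c p * mzv ![p.1, p.2]) := by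
    intro p hp
    simp only [pairsOfWeight, Finset.mem_filter] at hp
    refine (hasSum_mzvTerm _ hp.2.1 ?_).mul_left _
    intro i
    fin_cases i <;> simp <;> omega
  refine (hasSum_sum h).congr_fun ?_
  intro v
  simp only [mzvTerm, strictAnti_fin_two]
  split_ifs
  · simp [Fin.prod_univ_two, mul_comm]
  · simp

theorem hasSum_depth_one {n : ℕ} (hn : 2 ≤ n) (c : ℝ) :
    HasSum (fun v : Fin 1 → ℕ+ => c * ((v 0 : ℕ) : ℝ)⁻¹ ^ n) (c * mzv ![n]) := by
  refine ((hasSum_mzvTerm ![n] hn (by simp; omega)).mul_left c).congr_fun ?_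
  intro v
  simp [mzvTerm, Subsingleton.strictAnti]

theorem hasSum_perm {f : ℕ+ → ℕ+ → ℕ+ → ℝ} {s : ℝ}
    (h : HasSum (fun v : Fin 3 → ℕ+ => f (v 0) (v 1) (v 2)) s) (σ : Equiv.Perm (Fin 3)) :
    HasSum (fun v : Fin 3 → ℕ+ => f (v (σ 0)) (v (σ 1)) (v (σ 2))) s := by
  exact ((Equiv.arrowCongr σ.symm (Equiv.refl ℕ+)).hasSum_iff).2 h

theorem hasSum_perms {f : ℝ → ℝ → ℝ → ℕ+ → ℕ+ → ℕ+ → ℝ} {s : ℝ → ℝ → ℝ → ℝ}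
    (h : ∀ a b c, HasSum (fun v : Fin 3 → ℕ+ => f a b c (v 0) (v 1) (v 2)) (s a b c))
    (a b c : ℝ) :
    HasSum (fun v : Fin 3 → ℕ+ => f a b c (v 0) (v 1) (v 2) + f a c b (v 0) (v 2) (v 1) +
      f b a c (v 1) (v 0) (v 2) + f b c a (v 1) (v 2) (v 0) + f c a b (v 2) (v 0) (v 1) +
      f c b a (v 2) (v 1) (v 0)) (symSum a b c s) := by
  rw [symSum_eq]
  have h1 := hasSum_perm (h a c b) (Equiv.swap 1 2)
  have h2 := hasSum_perm (h b a c) (Equiv.swap 0 1)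
  have h3 := hasSum_perm (h b c a) (Equiv.swap 0 1 * Equiv.swap 1 2)
  have h4 := hasSum_perm (h c a b) (Equiv.swap 0 2 * Equiv.swap 1 2)
  have h5 := hasSum_perm (h c b a) (Equiv.swap 0 2)
  exact (((((h a b c).add h1).add h2).add h3).add h4).add h5

/-- The map `(x, y, z) ↦ (x+y+z, x+y, x)` is a bijection from triples of positive integers onto
strictly decreasing ones, with consecutive differences as inverse. -/
theorem hasSum_shuffleTerm (m : ℕ) (a b c : ℝ) :
    HasSum (fun v : Fin 3 → ℕ+ => shuffleTerm m a b c
      ((v 0 : ℕ) + (v 1 : ℕ) + (v 2 : ℕ)) ((v 0 : ℕ) + (v 1 : ℕ)) (v 0 : ℕ))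
      (∑ p ∈ triplesOfWeight (m + 3),
        shuffleCoeff (p 0) (p 1) (p 2) a b c * mzv ![p 0, p 1, p 2]) := by
  have h := hasSum_triple (m + 3) (fun p => shuffleCoeff (p 0) (p 1) (p 2) a b c)
  simp only [← shuffleTerm_eq_sum] at h
  let g : (Fin 3 → ℕ+) → (Fin 3 → ℕ+) := fun v => ![v 0 + v 1 + v 2, v 0 + v 1, v 0]
  have hg : Function.Injective g := by
    intro v w hvw
    have h0 : v 0 + v 1 + v 2 = w 0 + w 1 + w 2 := congrFun hvw 0
    have h1 : v 0 + v 1 = w 0 + w 1 := congrFun hvw 1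
    have h2 : v 0 = w 0 := congrFun hvw 2
    rw [h1] at h0
    rw [h2] at h1
    funext i
    fin_cases i
    · exact h2
    · exact (add_left_cancel h1)
    · exact (add_left_cancel h0)
  rw [← hg.hasSum_iff] at h
  · refine h.congr_fun ?_
    intro v
    have h1 : v 0 < v 0 + v 1 := PNat.lt_add_right _ _
    have h2 : v 0 + v 1 < v 0 + v 1 + v 2 := PNat.lt_add_right _ _
    simp [g, h1, h2]
  · intro v hv
    rw [if_neg]
    rintro ⟨h1, h2⟩
    refine hv ⟨![v 2, v 1 - v 2, v 0 - v 1], ?_⟩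
    ext i
    fin_cases i
    · simp [g, PNat.add_sub_of_lt h1, PNat.add_sub_of_lt h2]
    · simp [g, PNat.add_sub_of_lt h1]
    · simp [g]

/-- The shuffle product formula, in generating function form. -/
theorem hasSum_stuffleTerm_shuffle (m : ℕ) (a b c : ℝ) :
    HasSum (fun v : Fin 3 → ℕ+ => stuffleTerm m a b c (v 0 : ℕ) (v 1 : ℕ) (v 2 : ℕ))
      (symSum a b c fun a b c => ∑ p ∈ triplesOfWeight (m + 3),
        shuffleCoeff (p 0) (p 1) (p 2) a b c * mzv ![p 0, p 1, p 2]) := by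
  have h := hasSum_perms (f := fun a b c x y z => shuffleTerm m a b c
    ((x : ℕ) + (y : ℕ) + (z : ℕ)) ((x : ℕ) + (y : ℕ)) (x : ℕ)) (hasSum_shuffleTerm m) a b c
  refine h.congr_fun ?_
  intro v
  have hv : ∀ i, (0 : ℝ) < (v i : ℕ) := fun i => by exact_mod_cast (v i).2
  exact (stuffleTerm_eq_shuffleTerm m a b c (hv 0) (hv 1) (hv 2))

theorem hasSum_stuffle_strict (m : ℕ) (a b c : ℝ) :
    HasSum (fun v : Fin 3 → ℕ+ => if v 2 < v 1 ∧ v 1 < v 0 then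
      stuffleTerm m a b c (v 0 : ℕ) (v 1 : ℕ) (v 2 : ℕ) else 0)
      (∑ p ∈ triplesOfWeight (m + 3),
        stuffleCoeff (p 0) (p 1) (p 2) a b c * mzv ![p 0, p 1, p 2]) := by
  have h := hasSum_triple (m + 3) (fun p => stuffleCoeff (p 0) (p 1) (p 2) a b c)
  simp only [← stuffleTerm_eq_sum] at h
  exact h

theorem hasSum_stuffle_left (m : ℕ) (a b c : ℝ) :
    HasSum (fun v : Fin 3 → ℕ+ => if v 0 = v 1 ∧ v 2 < v 1 then
      stuffleTerm m a b c (v 0 : ℕ) (v 1 : ℕ) (v 2 : ℕ) else 0)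
      (∑ p ∈ pairsOfWeight (m + 3),
        innerCoeff p.1 a b * (c ^ (p.2 - 1) - 0 ^ (p.2 - 1)) * mzv ![p.1, p.2]) := by
  have h := hasSum_pair (m + 3)
    (fun p => innerCoeff p.1 a b * (c ^ (p.2 - 1) - 0 ^ (p.2 - 1)))
  simp only [← stuffleTerm_diag_left] at h
  let g : (Fin 2 → ℕ+) → (Fin 3 → ℕ+) := fun v => ![v 0, v 0, v 1]
  have hg : Function.Injective g := by
    intro v w hvw
    funext i
    fin_cases i
    · exact (congrFun hvw 0)
    · exact (congrFun hvw 2)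
  rw [← hg.hasSum_iff]
  · refine h.congr_fun ?_
    intro v
    simp [g]
  · intro v hv
    rw [if_neg]
    rintro ⟨h1, h2⟩
    refine hv ⟨![v 0, v 2], ?_⟩
    ext i
    fin_cases i <;> simp [g, h1]

theorem hasSum_stuffle_right (m : ℕ) (a b c : ℝ) :
    HasSum (fun v : Fin 3 → ℕ+ => if v 1 < v 0 ∧ v 1 = v 2 then
      stuffleTerm m a b c (v 0 : ℕ) (v 1 : ℕ) (v 2 : ℕ) else 0)
      (∑ p ∈ pairsOfWeight (m + 3),
        (a ^ (p.1 - 1) - 0 ^ (p.1 - 1)) * innerCoeff p.2 b c * mzv ![p.1, p.2]) := by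
  have h := hasSum_pair (m + 3)
    (fun p => (a ^ (p.1 - 1) - 0 ^ (p.1 - 1)) * innerCoeff p.2 b c)
  simp only [← stuffleTerm_diag_right] at h
  let g : (Fin 2 → ℕ+) → (Fin 3 → ℕ+) := fun v => ![v 0, v 1, v 1]
  have hg : Function.Injective g := by
    intro v w hvw
    funext i
    fin_cases i
    · exact (congrFun hvw 0)
    · exact (congrFun hvw 2)
  rw [← hg.hasSum_iff]
  · refine h.congr_fun ?_
    intro v
    simp [g]
  · intro v hv
    rw [if_neg]
    rintro ⟨h1, h2⟩
    refine hv ⟨![v 0, v 1], ?_⟩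
    ext i
    fin_cases i <;> simp [g, h2]

theorem hasSum_stuffle_diag (m : ℕ) (a b c : ℝ) :
    HasSum (fun v : Fin 3 → ℕ+ => if v 0 = v 1 ∧ v 1 = v 2 then
      stuffleTerm m a b c (v 0 : ℕ) (v 1 : ℕ) (v 2 : ℕ) else 0)
      (diagCoeff m a b c * mzv ![m + 3]) := by
  have h := hasSum_depth_one (n := m + 3) (by omega) (diagCoeff m a b c)
  simp only [← stuffleTerm_diag] at h
  let g : (Fin 1 → ℕ+) → (Fin 3 → ℕ+) := fun v => ![v 0, v 0, v 0]
  have hg : Function.Injective g := by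
    intro v w hvw
    funext i
    fin_cases i
    exact (congrFun hvw 0)
  rw [← hg.hasSum_iff]
  · refine h.congr_fun ?_
    intro v
    simp [g]
  · intro v hv
    rw [if_neg]
    rintro ⟨h1, h2⟩
    refine hv ⟨![v 0], ?_⟩
    ext i
    fin_cases i <;> simp [g, h1, h2]

/-- Over the six permutations a strict order occurs once, but a pattern with exactly one tie occurs
twice, since swapping the tied variables repeats it; hence the factors `1/2`. -/
theorem eq_sum_ite_order (x y z : ℕ+) (t : ℝ) :
    t = (((if z < y ∧ y < x then t else 0) + (if y < z ∧ z < x then t else 0) +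
        (if z < x ∧ x < y then t else 0) + (if x < z ∧ z < y then t else 0) +
        (if y < x ∧ x < z then t else 0) + (if x < y ∧ y < z then t else 0)) +
      1 / 2 * ((if x = y ∧ z < y then t else 0) + (if x = z ∧ y < z then t else 0) +
        (if y = x ∧ z < x then t else 0) + (if y = z ∧ x < z then t else 0) +
        (if z = x ∧ y < x then t else 0) + (if z = y ∧ x < y then t else 0))) +
      1 / 2 * ((if y < x ∧ y = z then t else 0) + (if z < x ∧ z = y then t else 0) +
        (if x < y ∧ x = z then t else 0) + (if z < y ∧ z = x then t else 0) +
        (if x < z ∧ x = y then t else 0) + (if y < z ∧ y = x then t else 0)) +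
      (if x = y ∧ y = z then t else 0) := by
  rcases lt_trichotomy x y with h1 | rfl | h1
  · rcases lt_trichotomy y z with h2 | rfl | h2
    · have h3 := h1.trans h2
      simp [h1, h2, h3, h1.not_gt, h2.not_gt, h3.not_gt, h1.ne, h2.ne, h3.ne, h1.ne', h2.ne',
        h3.ne']
    · simp [h1, h1.not_gt, h1.ne, h1.ne']; ring
    · rcases lt_trichotomy x z with h3 | rfl | h3
      · simp [h1, h2, h3, h1.not_gt, h2.not_gt, h3.not_gt, h1.ne, h2.ne, h3.ne, h1.ne', h2.ne',
          h3.ne']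
      · simp [h1, h1.not_gt, h1.ne, h1.ne']; ring
      · simp [h1, h2, h3, h1.not_gt, h2.not_gt, h3.not_gt, h1.ne, h2.ne, h3.ne, h1.ne', h2.ne',
          h3.ne']
  · rcases lt_trichotomy x z with h2 | rfl | h2
    · simp [h2, h2.not_gt, h2.ne, h2.ne']; ring
    · simp
    · simp [h2, h2.not_gt, h2.ne, h2.ne']; ring
  · rcases lt_trichotomy x z with h2 | rfl | h2
    · have h3 := h1.trans h2
      simp [h1, h2, h3, h1.not_gt, h2.not_gt, h3.not_gt, h1.ne, h2.ne, h3.ne, h1.ne', h2.ne',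
        h3.ne']
    · simp [h1, h1.not_gt, h1.ne, h1.ne']; ring
    · rcases lt_trichotomy y z with h3 | rfl | h3
      · simp [h1, h2, h3, h1.not_gt, h2.not_gt, h3.not_gt, h1.ne, h2.ne, h3.ne, h1.ne', h2.ne',
          h3.ne']
      · simp [h1, h1.not_gt, h1.ne, h1.ne']; ring
      · simp [h1, h2, h3, h1.not_gt, h2.not_gt, h3.not_gt, h1.ne, h2.ne, h3.ne, h1.ne', h2.ne',
          h3.ne']

/-- The stuffle product formula, in generating function form. -/
theorem hasSum_stuffleTerm_stuffle (m : ℕ) (a b c : ℝ) :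
    HasSum (fun v : Fin 3 → ℕ+ => stuffleTerm m a b c (v 0 : ℕ) (v 1 : ℕ) (v 2 : ℕ))
      ((symSum a b c fun a b c => ∑ p ∈ triplesOfWeight (m + 3),
        stuffleCoeff (p 0) (p 1) (p 2) a b c * mzv ![p 0, p 1, p 2]) +
      1 / 2 * (symSum a b c fun a b c => ∑ p ∈ pairsOfWeight (m + 3),
        innerCoeff p.1 a b * (c ^ (p.2 - 1) - 0 ^ (p.2 - 1)) * mzv ![p.1, p.2]) +
      1 / 2 * (symSum a b c fun a b c => ∑ p ∈ pairsOfWeight (m + 3),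
        (a ^ (p.1 - 1) - 0 ^ (p.1 - 1)) * innerCoeff p.2 b c * mzv ![p.1, p.2]) +
      diagCoeff m a b c * mzv ![m + 3]) := by
  have h1 := hasSum_perms (f := fun a b c x y z => if z < y ∧ y < x then
    stuffleTerm m a b c (x : ℕ) (y : ℕ) (z : ℕ) else 0) (hasSum_stuffle_strict m) a b c
  have h2 := hasSum_perms (f := fun a b c x y z => if x = y ∧ z < y then
    stuffleTerm m a b c (x : ℕ) (y : ℕ) (z : ℕ) else 0) (hasSum_stuffle_left m) a b c
  have h3 := hasSum_perms (f := fun a b c x y z => if y < x ∧ y = z then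
    stuffleTerm m a b c (x : ℕ) (y : ℕ) (z : ℕ) else 0) (hasSum_stuffle_right m) a b c
  have h4 := hasSum_stuffle_diag m a b c
  refine (((h1.add (h2.mul_left (1 / 2))).add (h3.mul_left (1 / 2))).add h4).congr_fun ?_
  intro v
  obtain ⟨e1, e2, e3, e4, e5⟩ := stuffleTerm_perm m a b c (v 0 : ℕ) (v 1 : ℕ) (v 2 : ℕ)
  simp only [e1, e2, e3, e4, e5]
  exact (eq_sum_ite_order _ _ _ _)

/-! ### Comparison with the identity, depth by depth -/

section

open Finset

theorem symSum_add (a b c : ℝ) (f g : ℝ → ℝ → ℝ → ℝ) :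
    symSum a b c (fun x y z => f x y z + g x y z) = symSum a b c f + symSum a b c g := by
  simp only [symSum, sum_add_distrib]

theorem symSum_sum {ι : Type*} (s : Finset ι) (a b c : ℝ) (f : ι → ℝ → ℝ → ℝ → ℝ) :
    symSum a b c (fun x y z => ∑ p ∈ s, f p x y z) = ∑ p ∈ s, symSum a b c (f p) := by
  simp only [symSum]
  exact sum_comm

theorem sum_pairs_eq_triples_right (n : ℕ) (f : ℕ → ℕ → ℕ → ℝ) :
    ∑ p ∈ pairsOfWeight (n - 1), f p.1 p.2 1 =
      ∑ p ∈ triplesOfWeight n, if p 2 = 1 then f (p 0) (p 1) (p 2) else 0 := by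
  rw [← sum_filter]
  refine sum_nbij' (fun p => ![p.1, p.2, 1]) (fun p => (p 0, p 1)) ?_ ?_ ?_ ?_ ?_
  · rintro ⟨j, k⟩ h
    simp [pairsOfWeight] at h
    simp [triplesOfWeight, Finset.Nat.mem_antidiagonalTuple, Fin.sum_univ_three]
    omega
  · intro p h
    simp [triplesOfWeight, Finset.Nat.mem_antidiagonalTuple, Fin.sum_univ_three] at h
    simp [pairsOfWeight]
    omega
  · intro p _
    rfl
  · intro p h
    ext i
    fin_cases i <;> simp [(mem_filter.1 h).2]
  · intro p _
    rfl

theorem sum_pairs_eq_triples_mid (n : ℕ) (f : ℕ → ℕ → ℕ → ℝ) :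
    ∑ p ∈ pairsOfWeight (n - 1), f p.1 1 p.2 =
      ∑ p ∈ triplesOfWeight n, if p 1 = 1 then f (p 0) (p 1) (p 2) else 0 := by
  rw [← sum_filter]
  refine sum_nbij' (fun p => ![p.1, 1, p.2]) (fun p => (p 0, p 2)) ?_ ?_ ?_ ?_ ?_
  · rintro ⟨j, k⟩ h
    simp [pairsOfWeight] at h
    simp [triplesOfWeight, Finset.Nat.mem_antidiagonalTuple, Fin.sum_univ_three]
    omega
  · intro p h
    simp [triplesOfWeight, Finset.Nat.mem_antidiagonalTuple, Fin.sum_univ_three] at h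
    simp [pairsOfWeight]
    omega
  · intro p _
    rfl
  · intro p h
    ext i
    fin_cases i <;> simp [(mem_filter.1 h).2]
  · intro p _
    rfl

/-- Powers of zero survive only for last exponent `1` or middle exponent `1`; they account for
`ζ(j,k,1)` and `ζ(j,1,k)`. The case split evaluates them, and the rest agrees after symmetrization.
-/
theorem depth_three_coeff (j k l : ℕ) (a b c Z : ℝ) :
    symSum a b c (fun a b c => (a * c * (a + b + c) ^ (j + 1) * (a + b) ^ k * b ^ (l + 1)
        - a * c * (a + b) ^ (j + k + 1) * b ^ (l + 1)
        - a * c * (b + c) ^ (j + 1) * b ^ (k + l + 1)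
        + a * c * b ^ (j + k + l + 2)
        - a ^ (j + 2) * b ^ (k + 1) * c ^ (l + 1)) * Z)
      - symSum a b c (fun a b c =>
        (if l + 1 = 1 then
          a ^ (k + 1) * b * c * ((a + c) ^ (j + 1) - a ^ (j + 1) - c ^ (j + 1)) * Z else 0)
        - if k + 1 = 1 then a ^ (j + 2) * b * c ^ (l + 1) * Z else 0) =
    a * b * c * (symSum a b c (fun a b c => shuffleCoeff (j + 2) (k + 1) (l + 1) a b c * Z) -
      symSum a b c (fun a b c => stuffleCoeff (j + 2) (k + 1) (l + 1) a b c * Z)) := by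
  simp only [symSum_eq, shuffleCoeff, stuffleCoeff, mixedDiff]
  rcases k with _ | k <;> rcases l with _ | l <;> simp <;> ring

theorem depth_three (n : ℕ) (a b c : ℝ) :
    symSum a b c (fun a b c => ∑ p ∈ triplesOfWeight n,
      (a * c * (a + b + c) ^ (p 0 - 1) * (a + b) ^ (p 1 - 1) * b ^ p 2
        - a * c * (a + b) ^ (p 0 + p 1 - 2) * b ^ p 2
        - a * c * (b + c) ^ (p 0 - 1) * b ^ (p 1 + p 2 - 1)
        + a * c * b ^ (p 0 + p 1 + p 2 - 2)
        - a ^ p 0 * b ^ p 1 * c ^ p 2) * mzv ![p 0, p 1, p 2])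
    - symSum a b c (fun a b c => ∑ p ∈ pairsOfWeight (n - 1),
        (a ^ p.2 * b * c * ((a + c) ^ (p.1 - 1) - a ^ (p.1 - 1) - c ^ (p.1 - 1)) *
          mzv ![p.1, p.2, 1] - a ^ p.1 * b * c ^ p.2 * mzv ![p.1, 1, p.2])) =
    a * b * c * (
      symSum a b c (fun a b c => ∑ p ∈ triplesOfWeight n,
        shuffleCoeff (p 0) (p 1) (p 2) a b c * mzv ![p 0, p 1, p 2]) -
      symSum a b c (fun a b c => ∑ p ∈ triplesOfWeight n,
        stuffleCoeff (p 0) (p 1) (p 2) a b c * mzv ![p 0, p 1, p 2])) := by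
  have h1 : ∀ a b c : ℝ, ∑ p ∈ pairsOfWeight (n - 1),
      (a ^ p.2 * b * c * ((a + c) ^ (p.1 - 1) - a ^ (p.1 - 1) - c ^ (p.1 - 1)) *
          mzv ![p.1, p.2, 1] - a ^ p.1 * b * c ^ p.2 * mzv ![p.1, 1, p.2]) =
      ∑ p ∈ triplesOfWeight n, ((if p 2 = 1 then
        a ^ p 1 * b * c * ((a + c) ^ (p 0 - 1) - a ^ (p 0 - 1) - c ^ (p 0 - 1)) *
          mzv ![p 0, p 1, p 2] else 0)
        - if p 1 = 1 then a ^ p 0 * b * c ^ p 2 * mzv ![p 0, p 1, p 2] else 0) := by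
    intro a b c
    rw [sum_sub_distrib, sum_sub_distrib,
      sum_pairs_eq_triples_right n (fun j k l => a ^ k * b * c *
        ((a + c) ^ (j - 1) - a ^ (j - 1) - c ^ (j - 1)) * mzv ![j, k, l]),
      sum_pairs_eq_triples_mid n (fun j k l => a ^ j * b * c ^ l * mzv ![j, k, l])]
  simp only [h1, symSum_sum]
  rw [← sum_sub_distrib, ← sum_sub_distrib, mul_sum]
  refine sum_congr rfl fun p hp => ?_
  simp only [triplesOfWeight, mem_filter] at hp
  obtain ⟨j, hj⟩ := Nat.exists_eq_add_of_le' hp.2.1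
  obtain ⟨k, hk⟩ := Nat.exists_eq_add_of_le' hp.2.2.1
  obtain ⟨l, hl⟩ := Nat.exists_eq_add_of_le' hp.2.2.2
  rw [hj, hk, hl, ← depth_three_coeff]
  congr 1
  rw [show j + 2 - 1 = j + 1 by omega, show k + 1 - 1 = k by omega,
    show j + 2 + (k + 1) - 2 = j + k + 1 by omega,
    show k + 1 + (l + 1) - 1 = k + l + 1 by omega,
    show j + 2 + (k + 1) + (l + 1) - 2 = j + k + l + 2 by omega]

theorem sum_antidiagonal_pow {a b : ℝ} (h : a ≠ b) (m : ℕ) :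
    ∑ p ∈ antidiagonal m, a ^ p.1 * b ^ p.2 = (a ^ (m + 1) - b ^ (m + 1)) * (a - b)⁻¹ := by
  have h1 := geom_sum₂_mul a b (m + 1)
  rw [Finset.Nat.sum_antidiagonal_eq_sum_range_succ (fun i j => a ^ i * b ^ j), ← h1,
    mul_assoc, mul_inv_cancel₀ (sub_ne_zero.2 h), mul_one]
  simp

theorem sum_antidiagonal_mul_zero_pow (f : ℕ → ℝ) (m : ℕ) :
    ∑ p ∈ antidiagonal m, f p.1 * 0 ^ p.2 = f m := by
  cases m with
  | zero => simp
  | succ m => simp [Finset.Nat.sum_antidiagonal_succ']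

theorem sum_antidiagonal_zero_pow_mul (f : ℕ → ℝ) (m : ℕ) :
    ∑ p ∈ antidiagonal m, 0 ^ p.1 * f p.2 = f m := by
  cases m with
  | zero => simp
  | succ m => simp [Finset.Nat.sum_antidiagonal_succ]

theorem innerCoeff_eq {a b : ℝ} (h : a ≠ b) (k : ℕ) :
    innerCoeff (k + 2) a b =
      (a ^ (k + 1) - b ^ (k + 1)) * (a - b)⁻¹ - a ^ k - b ^ k + 0 ^ k := by
  simp only [innerCoeff, mul_sub, sub_mul, sum_sub_distrib]
  rw [sum_antidiagonal_pow h, sum_antidiagonal_mul_zero_pow (fun i => a ^ i),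
    sum_antidiagonal_mul_zero_pow (fun i => 0 ^ i), sum_antidiagonal_zero_pow_mul (fun i => b ^ i)]
  ring

theorem innerCoeff_one (a b : ℝ) : innerCoeff 1 a b = 0 := rfl

theorem diagCoeff_eq {a b c : ℝ} (hab : a ≠ b) (hac : a ≠ c) (hbc : b ≠ c) (m : ℕ) :
    diagCoeff (m + 1) a b c =
      (a * (a ^ (m + 2) - c ^ (m + 2)) * (a - c)⁻¹ - b * (b ^ (m + 2) - c ^ (m + 2)) * (b - c)⁻¹) *
        (a - b)⁻¹ - (a ^ (m + 2) - c ^ (m + 2)) * (a - c)⁻¹ -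
        (b ^ (m + 2) - c ^ (m + 2)) * (b - c)⁻¹ -
        (a ^ (m + 2) - b ^ (m + 2)) * (a - b)⁻¹ + a ^ (m + 1) + b ^ (m + 1) + c ^ (m + 1) := by
  simp only [diagCoeff, mul_sub, sum_sub_distrib]
  rw [sum_antidiagonal_mul_zero_pow (fun i => innerCoeff (i + 2) a b)]
  have h1 : ∀ p : ℕ × ℕ, innerCoeff (p.1 + 2) a b * c ^ p.2 =
      (a * (a ^ p.1 * c ^ p.2) - b * (b ^ p.1 * c ^ p.2)) * (a - b)⁻¹ - a ^ p.1 * c ^ p.2 -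
        b ^ p.1 * c ^ p.2 + 0 ^ p.1 * c ^ p.2 := by
    intro p
    rw [innerCoeff_eq hab]
    ring
  simp only [h1, sum_add_distrib, sum_sub_distrib, ← sum_mul, ← mul_sum]
  rw [sum_antidiagonal_pow hac, sum_antidiagonal_pow hbc,
    sum_antidiagonal_zero_pow_mul (fun i => c ^ i), innerCoeff_eq hab]
  simp only [pow_succ, mul_zero]
  ring

/-- The rational terms come from summing geometric progressions in the triple-tie coefficient. -/
theorem depth_one_coeff {a b c : ℝ} (hab : a ≠ b) (hac : a ≠ c) (hbc : b ≠ c) (m : ℕ) :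
    cycSum b c (fun b c =>
      1 / (c - b) * ((a * b * c ^ (m + 4) - b * c * a ^ (m + 4)) / (c - a)
          + a * c * b ^ (m + 3))
        - a * c * (b ^ (m + 3) - a ^ (m + 3)) / (b - a) + c * a ^ (m + 3))
      + symSum a b c (fun a b c => 1 / 2 * a ^ (m + 2) * b * c) =
      a * b * c * diagCoeff (m + 1) a b c := by
  rw [diagCoeff_eq hab hac hbc, cycSum_eq, symSum_eq]
  have h1 := sub_ne_zero.2 hab
  have h2 := sub_ne_zero.2 hac
  have h3 := sub_ne_zero.2 hbc
  rw [← neg_sub b c, ← neg_sub a c, ← neg_sub a b]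
  field_simp
  ring

/-- At `k = 0` the tie coefficients vanish, so the `ζ(n-1,1)` terms must cancel among themselves.
For `k = 1` or `j = 0` the correction `0^k` in `innerCoeff_eq` equals `1` and produces the
`ζ(n-2,2)` and `ζ(2,n-2)` terms. -/
theorem depth_two_coeff {a b c : ℝ} (hab : a ≠ b) (hac : a ≠ c) (hbc : b ≠ c) (j k : ℕ)
    (hjk : 1 ≤ j + k) (Z : ℝ) :
    symSum a b c (fun a b c => (c * a ^ (j + 2) * b ^ k + c * a ^ (k + 1) * b ^ (j + 1)
        - b * (a ^ (j + 2) * c ^ (k + 1) + a ^ (k + 1) * c ^ (j + 2)) / (c - b)) * Z)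
      - symSum a b c (fun a b c =>
        (if k = 0 then (a ^ (j + k + 2) * c + a ^ (j + k + 1) * b * c
          - a * b * c ^ (j + k + 2) / (c - b)) * Z else 0) +
        ((if k = 1 then 1 / 2 * a ^ (j + k + 1) * b * c * Z else 0) +
         (if j = 0 then 1 / 2 * a ^ (j + k + 1) * b * c * Z else 0))) =
    -(a * b * c * (1 / 2 * symSum a b c (fun a b c =>
        innerCoeff (j + 2) a b * (c ^ k - 0 ^ k) * Z) +
      1 / 2 * symSum a b c (fun a b c =>
        (a ^ (j + 1) - 0 ^ (j + 1)) * innerCoeff (k + 1) b c * Z))) := by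
  have e1 : (c - b)⁻¹ = -(b - c)⁻¹ := by rw [← neg_sub, inv_neg]
  have e2 : (c - a)⁻¹ = -(a - c)⁻¹ := by rw [← neg_sub, inv_neg]
  have e3 : (b - a)⁻¹ = -(a - b)⁻¹ := by rw [← neg_sub, inv_neg]
  rcases k with _ | k
  · have hj : j ≠ 0 := by omega
    simp only [symSum_eq, zero_add, innerCoeff_one, innerCoeff_eq hab, innerCoeff_eq hac, innerCoeff_eq hbc,
      innerCoeff_eq hab.symm, innerCoeff_eq hac.symm, innerCoeff_eq hbc.symm, div_eq_mul_inv,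
      e1, e2, e3, if_neg hj]
    simp
    ring
  · simp only [symSum_eq, innerCoeff_eq hab, innerCoeff_eq hac, innerCoeff_eq hbc,
      innerCoeff_eq hab.symm, innerCoeff_eq hac.symm, innerCoeff_eq hbc.symm, div_eq_mul_inv,
      e1, e2, e3]
    rcases k with _ | k <;> rcases j with _ | j <;> simp <;> ring

theorem depth_two {a b c : ℝ} (hab : a ≠ b) (hac : a ≠ c) (hbc : b ≠ c) (n : ℕ) (hn : 4 ≤ n) :
    symSum a b c (fun a b c => ∑ p ∈ pairsOfWeight n,
      (c * a ^ p.1 * b ^ (p.2 - 1) + c * a ^ p.2 * b ^ (p.1 - 1)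
        - b * (a ^ p.1 * c ^ p.2 + a ^ p.2 * c ^ p.1) / (c - b)) * mzv ![p.1, p.2])
    - symSum a b c (fun a b c =>
      (a ^ (n - 1) * c + a ^ (n - 2) * b * c - a * b * c ^ (n - 1) / (c - b)) * mzv ![n - 1, 1]
      + 1 / 2 * a ^ (n - 2) * b * c * (mzv ![n - 2, 2] + mzv ![2, n - 2])) =
    -(a * b * c * (1 / 2 * (symSum a b c fun a b c => ∑ p ∈ pairsOfWeight n,
        innerCoeff p.1 a b * (c ^ (p.2 - 1) - 0 ^ (p.2 - 1)) * mzv ![p.1, p.2]) +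
      1 / 2 * (symSum a b c fun a b c => ∑ p ∈ pairsOfWeight n,
        (a ^ (p.1 - 1) - 0 ^ (p.1 - 1)) * innerCoeff p.2 b c * mzv ![p.1, p.2]))) := by
  -- The indicators are kept separate because `(n-2, 2)` and `(2, n-2)` coincide for `n = 4` and
  -- both must count.
  have h1 : ∀ a b c : ℝ,
      (a ^ (n - 1) * c + a ^ (n - 2) * b * c - a * b * c ^ (n - 1) / (c - b)) * mzv ![n - 1, 1]
      + 1 / 2 * a ^ (n - 2) * b * c * (mzv ![n - 2, 2] + mzv ![2, n - 2]) =
      ∑ p ∈ pairsOfWeight n, ((if p = (n - 1, 1) then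
          (a ^ (n - 1) * c + a ^ (n - 2) * b * c - a * b * c ^ (n - 1) / (c - b)) *
          mzv ![p.1, p.2] else 0) +
        ((if p = (n - 2, 2) then 1 / 2 * a ^ (n - 2) * b * c * mzv ![p.1, p.2] else 0) +
         (if p = (2, n - 2) then 1 / 2 * a ^ (n - 2) * b * c * mzv ![p.1, p.2] else 0))) := by
    intro a b c
    simp only [sum_add_distrib, sum_ite_eq']
    rw [if_pos, if_pos, if_pos, mul_add]
    all_goals
      simp only [pairsOfWeight, mem_filter, HasAntidiagonal.mem_antidiagonal]
      omega
  simp only [h1, symSum_sum, mul_sum, ← sum_sub_distrib, ← sum_add_distrib, ← sum_neg_distrib]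
  refine sum_congr rfl fun p hp => ?_
  simp only [pairsOfWeight, mem_filter, HasAntidiagonal.mem_antidiagonal] at hp
  obtain ⟨hp0, hp1, hp2⟩ := hp
  obtain ⟨x, y⟩ := p
  obtain ⟨j, rfl⟩ := Nat.exists_eq_add_of_le' hp1
  obtain ⟨k, rfl⟩ := Nat.exists_eq_add_of_le' hp2
  dsimp only at hp0 ⊢
  subst hp0
  rw [Nat.add_sub_cancel, show j + 2 - 1 = j + 1 by omega, ← depth_two_coeff hab hac hbc j k (by omega)]
  have c1 : ((j + 2, k + 1) = (j + 2 + (k + 1) - 1, 1)) ↔ k = 0 := by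
    rw [Prod.mk.injEq]; omega
  have c2 : ((j + 2, k + 1) = (j + 2 + (k + 1) - 2, 2)) ↔ k = 1 := by
    rw [Prod.mk.injEq]; omega
  have c3 : ((j + 2, k + 1) = (2, j + 2 + (k + 1) - 2)) ↔ j = 0 := by
    rw [Prod.mk.injEq]; omega
  simp only [c1, c2, c3]
  rw [show j + 2 + (k + 1) - 1 = j + k + 2 by omega, show j + 2 + (k + 1) - 2 = j + k + 1 by omega]

theorem identityLHS_eq_identityRHS (n : ℕ) (hn : 4 ≤ n) {a b c : ℝ} (hab : a ≠ b) (hac : a ≠ c)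
    (hbc : b ≠ c) : identityLHS n a b c = identityRHS n a b c := by
  have h3 := depth_three n a b c
  have h2 := depth_two hab hac hbc n hn
  obtain ⟨m, rfl⟩ := Nat.exists_eq_add_of_le' hn
  have h1 := depth_one_coeff hab hac hbc m
  have h0 := (hasSum_stuffleTerm_shuffle (m + 1) a b c).unique
    (hasSum_stuffleTerm_stuffle (m + 1) a b c)
  rw [show m + 4 - 1 = m + 3 by omega, show m + 4 - 2 = m + 2 by omega] at h2
  rw [show m + 4 - 1 = m + 3 by omega] at h3
  rw [show m + 1 + 3 = m + 4 by omega] at h0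
  rw [h0] at h3
  simp only [identityLHS, identityRHS]
  rw [show m + 4 - 1 = m + 3 by omega, show m + 4 - 2 = m + 2 by omega]
  simp only [symSum_add] at h2 h3 ⊢
  have e : ∀ f : ℝ → ℝ → ℝ → ℝ, symSum a b c (fun x y z => f x y z * mzv ![m + 4]) =
      symSum a b c f * mzv ![m + 4] := by
    intro f
    simp only [symSum_eq, add_mul]
  rw [e]
  linear_combination h3 + h2 - mzv ![m + 4] * h1

/-! ### Removable poles and limits -/

/-- The right-hand side with its apparent poles removed. -/
def regularRHS (n : ℕ) (a₀ b₀ c₀ : ℝ) : ℝ :=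
  symSum a₀ b₀ c₀ (fun a b c =>
    (∑ p ∈ pairsOfWeight (n - 1),
      (a ^ p.2 * b * c * ((a + c) ^ (p.1 - 1) - a ^ (p.1 - 1) - c ^ (p.1 - 1)) *
          mzv ![p.1, p.2, 1] - a ^ p.1 * b * c ^ p.2 * mzv ![p.1, 1, p.2]))
    + (a ^ (n - 1) * c + a ^ (n - 2) * b * c -
        1 / 2 * (a * b * c * ∑ p ∈ antidiagonal (n - 3), c ^ p.1 * b ^ p.2)) * mzv ![n - 1, 1]
    + 1 / 2 * a ^ (n - 2) * b * c * (mzv ![n - 2, 2] + mzv ![2, n - 2])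
    + 1 / 2 * a ^ (n - 2) * b * c * mzv ![n])

theorem continuous_regularRHS (n : ℕ) :
    Continuous fun p : ℝ × ℝ × ℝ => regularRHS n p.1 p.2.1 p.2.2 := by
  simp only [regularRHS, symSum_eq]
  fun_prop

/-- Exchanging `b` and `c` pairs the poles into `abc (c^(n-2) - b^(n-2))/(c-b)`, a geometric sum.
The factor `1/2` in `regularRHS` compensates for that sum being symmetric in `b, c`. -/
theorem identityRHS_eq_regularRHS (n : ℕ) (hn : 4 ≤ n) {a b c : ℝ} (hab : a ≠ b) (hac : a ≠ c)
    (hbc : b ≠ c) : identityRHS n a b c = regularRHS n a b c := by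
  obtain ⟨m, rfl⟩ := Nat.exists_eq_add_of_le' hn
  have e1 : (c - b)⁻¹ = -(b - c)⁻¹ := by rw [← neg_sub, inv_neg]
  have e2 : (c - a)⁻¹ = -(a - c)⁻¹ := by rw [← neg_sub, inv_neg]
  have e3 : (b - a)⁻¹ = -(a - b)⁻¹ := by rw [← neg_sub, inv_neg]
  simp only [identityRHS, regularRHS, symSum_add]
  congr 3
  rw [show m + 4 - 1 = m + 3 by omega, show m + 4 - 3 = m + 1 by omega]
  simp only [symSum_eq, sum_antidiagonal_pow hab, sum_antidiagonal_pow hac,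
    sum_antidiagonal_pow hbc, sum_antidiagonal_pow hab.symm, sum_antidiagonal_pow hac.symm,
    sum_antidiagonal_pow hbc.symm, div_eq_mul_inv, e1, e2, e3]
  ring

end

end

/-- The identity holds for pairwise distinct `a, b, c`; at an arbitrary real triple `(a, b, c)`
(where some of the denominators `c - b, c - a, b - a` may vanish) both sides extend by
continuity, with the same value. -/
theorem mainTheorem7 (n : ℕ) (hn : 4 ≤ n) (a b c : ℝ) :
    (a ≠ b → a ≠ c → b ≠ c → identityLHS n a b c = identityRHS n a b c) ∧
    ∃ v : ℝ,
      Tendsto (fun p : ℝ × ℝ × ℝ => identityLHS n p.1 p.2.1 p.2.2)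
        (𝓝[distinctTriples] (a, b, c)) (𝓝 v) ∧
      Tendsto (fun p : ℝ × ℝ × ℝ => identityRHS n p.1 p.2.1 p.2.2)
        (𝓝[distinctTriples] (a, b, c)) (𝓝 v) := by
  refine ⟨fun h1 h2 h3 => identityLHS_eq_identityRHS n hn h1 h2 h3, regularRHS n a b c, ?_⟩
  have h : Tendsto (fun p : ℝ × ℝ × ℝ => regularRHS n p.1 p.2.1 p.2.2)
      (𝓝[distinctTriples] (a, b, c)) (𝓝 (regularRHS n a b c)) :=
    ((continuous_regularRHS n).tendsto (a, b, c)).mono_left nhdsWithin_le_nhds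
  have hR : Tendsto (fun p : ℝ × ℝ × ℝ => identityRHS n p.1 p.2.1 p.2.2)
      (𝓝[distinctTriples] (a, b, c)) (𝓝 (regularRHS n a b c)) :=
    h.congr' (eventually_nhdsWithin_of_forall fun _ hp =>
      (identityRHS_eq_regularRHS n hn hp.1 hp.2.1 hp.2.2).symm)
  exact ⟨hR.congr' (eventually_nhdsWithin_of_forall fun _ hp =>
    (identityLHS_eq_identityRHS n hn hp.1 hp.2.1 hp.2.2).symm), hR⟩
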